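/- Let $n=p^t m$, where $p$ is an odd prime and $t\ge 1$, $m\ge 1$ are integers. Let $$T_{4n}=\langle a,b\mid a^{2n}=1,\ a^n=b^2,\ b^{-1}ab=a^{-1}\rangle$$ be the dicyclic group of order $4n$, and let $S=\{a^m,a^{-m}\}\cup\langle a\rangle b$. Let $\Gamma=\mathrm{Cay}(T_{4n},S)$ be the Cayley graph with vertex set $T_{4n}$ and edges $\{g,sg\}$ for $g\in T_{4n}$, $s\in S$, let $A$ be its adjacency matrix, and put $H(\tau)=\exp(\mathrm{i}\tau A)$ for $\tau\in\mathbb{R}$. Then $\Gamma$ admits pretty good fractional revival (PGFR); that is, there are two distinct vertices $u,v$ of $\Gamma$, a sequence $(\tau_k)$ of real numbers, and complex numbers $\alpha,\beta$ with $|\alpha|^2+|\beta|^2=1$ and $\beta\neq 0$ such that $$\lim_{k\to\infty}H(\tau_k)\,\mathbf{e}_u=\alpha\,\mathbf{e}_u+\beta\,\mathbf{e}_v,$$ where $\mathbf{e}_w$ denotes the standard basis vector of $\mathbb{C}^{T_{4n}}$ indexed by $w$. -/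

import Mathlib

/-!
The functions `a ^ x ↦ exp (π i j x / n)` supported on `⟨a⟩`, with `j ≠ 0`, are eigenvectors of `A`
for the eigenvalues `2 cos (π m j / n)`, and together with two vectors for the eigenvalues `2 ± 2 n`
they span all the `e_v` with `v ∈ ⟨a⟩`. Put `ω = exp (π i m / n)`, a primitive `2 p ^ t`-th root of
unity. An integral relation `∑ l_j θ_j = 0` among the eigenvalues is a polynomial relation for the
primitive `p ^ t`-th root of unity `-ω`, whose cyclotomic polynomial takes the value `p` at `1`.
Evaluating the relation at `1` thus yields `p ∣ 2 ∑ l_j (-1) ^ j`, since the contributions `± 2 n`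
are divisible by `p`. As `p` is odd, the phases `exp (± 2 π i / p)`, with sign `(-1) ^ j`, are
therefore compatible with all relations, and by Kronecker's theorem they are limits of
`exp (i τ θ_j)` at suitable times `τ`. In the limit, the even and the odd frequencies of `e_1` are
multiplied by conjugate phases; since `e_(a ^ n)` is `e_1` with the odd frequencies negated, the
result is `cos (2 π / p) e_1 + i sin (2 π / p) e_(a ^ n)`.

Kronecker's theorem is proved after Bohr: if the exponential sum `∑ exp (i τ θ_j) / z_j` with `d`
terms stayed below `B < d` in absolute value, then every Fourier coefficient of its `N`-th power
would be at most `B ^ N`, and so would every multinomial coefficient; but there are only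
polynomially many of these, and they add up to `d ^ N`.
-/

open Filter Topology

noncomputable section

namespace PGFR

/-- The Cayley graph `Cay(G, S)`: the vertices are the elements of `G`, and the edges are the pairs
`{g, s * g}` with `g ∈ G` and `s ∈ S` (loops, which occur only if `1 ∈ S`, are discarded). -/
def cayleyGraph {G : Type*} [Group G] (S : Set G) : SimpleGraph G :=
  SimpleGraph.fromRel fun g h => ∃ s ∈ S, h = s * g

/-- For an inverse-closed connection set without the identity, adjacency is the usual one. -/
theorem cayleyGraph_adj {G : Type*} [Group G] {S : Set G} (h1 : (1 : G) ∉ S)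
    (hS : ∀ s ∈ S, s⁻¹ ∈ S) (g h : G) :
    (cayleyGraph S).Adj g h ↔ ∃ s ∈ S, h = s * g := by
  unfold cayleyGraph
  rw [SimpleGraph.fromRel_adj]
  constructor
  · rintro ⟨-, h | ⟨s, hs, rfl⟩⟩
    · exact h
    · exact ⟨s⁻¹, hS s hs, by simp⟩
  · rintro ⟨s, hs, rfl⟩
    refine ⟨fun h => h1 ?_, Or.inl ⟨s, hs, rfl⟩⟩
    have : s = 1 := by simpa using h
    exact this ▸ hs

open Classical in
/-- The transition matrix `H(t) = exp(i t A)`, where `A` is the adjacency matrix of `Γ`. -/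
def transitionMatrix {V : Type*} [Fintype V] (Γ : SimpleGraph V) (t : ℝ) : Matrix V V ℂ :=
  NormedSpace.exp ((Complex.I * (t : ℂ)) • Γ.adjMatrix ℂ)

open Classical in
/-- `Γ` admits pretty good fractional revival from `u` to `v` (two distinct vertices): there are a
sequence of real times `τ k` and complex numbers `α`, `β` with `|α|² + |β|² = 1` and `β ≠ 0` such
that `H(τ k) e_u → α e_u + β e_v`. (For `β = 0` one speaks of approximate periodicity at `u`.) -/
def AdmitsPGFRFromTo {V : Type*} [Fintype V] (Γ : SimpleGraph V) (u v : V) : Prop :=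
  u ≠ v ∧ ∃ (τ : ℕ → ℝ) (α β : ℂ), ‖α‖ ^ 2 + ‖β‖ ^ 2 = 1 ∧ β ≠ 0 ∧
    Tendsto (fun k => (transitionMatrix Γ (τ k)).mulVec (Pi.single u 1)) atTop
      (𝓝 (α • Pi.single u 1 + β • Pi.single v 1 : V → ℂ))

/-- `Γ` admits pretty good fractional revival: it does so from some vertex to another one. -/
def AdmitsPGFR {V : Type*} [Fintype V] (Γ : SimpleGraph V) : Prop :=
  ∃ u v : V, AdmitsPGFRFromTo Γ u v

/-- The generator `a` of the dicyclic group
`T_{4n} = ⟨a, b | a ^ (2 n) = 1, a ^ n = b ^ 2, b⁻¹ a b = a⁻¹⟩`, which is `QuaternionGroup n`. -/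
def genA (n : ℕ) : QuaternionGroup n := QuaternionGroup.a 1

/-- The generator `b` of the dicyclic group `T_{4n}`. -/
def genB (n : ℕ) : QuaternionGroup n := QuaternionGroup.xa 0

/-- The connection set `S = {a ^ m, a ^ (-m)} ∪ ⟨a⟩ b` in `T_{4n}`. -/
def connectionSet (n m : ℕ) : Set (QuaternionGroup n) :=
  {genA n ^ m, (genA n ^ m)⁻¹} ∪
    {g | ∃ c ∈ Subgroup.zpowers (genA n), g = c * genB n}

end PGFR
end

namespace PGFR

theorem tendsto_average_circleExp_mul (μ : ℝ) :
    Tendsto (fun T : ℝ => T⁻¹ • ∫ t in (0 : ℝ)..T, (Circle.exp (t * μ) : ℂ)) atTop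
      (𝓝 (if μ = 0 then 1 else 0)) := by
  split_ifs with hμ
  · refine tendsto_const_nhds.congr' ?_
    filter_upwards [eventually_ne_atTop 0] with T hT
    simp [hμ, hT]
  · have hμI : (μ : ℂ) * Complex.I ≠ 0 := by simp [hμ]
    have integral_eq (T : ℝ) : ∫ t in (0 : ℝ)..T, (Circle.exp (t * μ) : ℂ) =
        (Circle.exp (T * μ) - 1) / (μ * Complex.I) := by
      simpa [Circle.coe_exp, mul_assoc, mul_comm, mul_left_comm] using
        integral_exp_mul_complex (a := 0) (b := T) hμI
    refine tendsto_inv_atTop_zero.zero_smul_isBoundedUnder_le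
      (isBoundedUnder_of ⟨2 / |μ|, fun T => ?_⟩)
    have norm_sub_le_two : ‖(Circle.exp (T * μ) : ℂ) - 1‖ ≤ 2 :=
      (norm_sub_le _ _).trans_eq (by rw [Circle.norm_coe, norm_one, one_add_one_eq_two])
    simp only [Function.comp_apply, integral_eq, norm_div, norm_mul, Complex.norm_I, mul_one,
      Complex.norm_real, Real.norm_eq_abs]
    gcongr

theorem norm_sum_filter_le_of_forall_norm_sum_le {κ : Type*} {s : Finset κ} {c : κ → ℂ} {μ : κ → ℝ}
    {B : ℝ} (hB : ∀ t : ℝ, ‖∑ k ∈ s, c k * Circle.exp (t * μ k)‖ ≤ B) (ν : ℝ) :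
    ‖∑ k ∈ s with μ k = ν, c k‖ ≤ B := by
  set f : ℝ → ℂ := fun t => ∑ k ∈ s, c k * Circle.exp (t * (μ k - ν)) with hf
  have norm_f_le (t : ℝ) : ‖f t‖ ≤ B := by
    have f_eq : f t = (∑ k ∈ s, c k * Circle.exp (t * μ k)) / Circle.exp (t * ν) := by
      simp only [hf, mul_sub, Circle.exp_sub, Circle.coe_div, Finset.sum_div, mul_div_assoc]
    simpa only [f_eq, norm_div, Circle.norm_coe, div_one] using hB t
  have average_tendsto : Tendsto (fun T : ℝ => T⁻¹ • ∫ t in (0 : ℝ)..T, f t) atTop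
      (𝓝 (∑ k ∈ s with μ k = ν, c k)) := by
    have h := tendsto_finsetSum s fun k _ =>
      (tendsto_average_circleExp_mul (μ k - ν)).const_mul (c k)
    convert h using 2 with T
    · rw [intervalIntegral.integral_finsetSum fun k _ =>
        Continuous.intervalIntegrable (by fun_prop) _ _, Finset.smul_sum]
      simp only [intervalIntegral.integral_const_mul, mul_smul_comm]
    · simp [Finset.sum_filter, sub_eq_zero]
  refine le_of_tendsto average_tendsto.norm ?_
  filter_upwards [eventually_gt_atTop 0] with T hT
  have norm_integral_le : ‖∫ t in (0 : ℝ)..T, f t‖ ≤ B * T := by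
    simpa [abs_of_pos hT] using
      intervalIntegral.norm_integral_le_of_norm_le_const (a := 0) (b := T) fun t _ => norm_f_le t
  rwa [norm_smul, norm_inv, Real.norm_of_nonneg hT.le, inv_mul_le_iff₀ hT, mul_comm T]

theorem circleExp_sum {ι : Type*} (s : Finset ι) (x : ι → ℝ) :
    Circle.exp (∑ i ∈ s, x i) = ∏ i ∈ s, Circle.exp (x i) :=
  map_sum Circle.expHom x s

theorem coe_circle_prod {ι : Type*} (s : Finset ι) (x : ι → Circle) :
    ((∏ i ∈ s, x i : Circle) : ℂ) = ∏ i ∈ s, (x i : ℂ) :=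
  map_prod Circle.coeHom x s

theorem card_univ_piAntidiag_le (ι : Type*) [Fintype ι] [DecidableEq ι] (N : ℕ) :
    ((Finset.univ : Finset ι).piAntidiag N).card ≤ (N + 1) ^ Fintype.card ι := by
  have subset_piFinset : (Finset.univ : Finset ι).piAntidiag N ⊆
      Fintype.piFinset fun _ => Finset.range (N + 1) := fun k hk => by
    refine Fintype.mem_piFinset.2 fun i => Finset.mem_range_succ_iff.2 ?_
    rw [← (Finset.mem_piAntidiag.1 hk).1]
    exact Finset.single_le_sum (fun _ _ => Nat.zero_le _) (Finset.mem_univ i)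
  simpa using Finset.card_le_card subset_piFinset

theorem exists_add_one_pow_mul_pow_lt_pow (d : ℕ) {B r : ℝ} (hB : 0 ≤ B) (hBr : B < r) :
    ∃ N : ℕ, ((N : ℝ) + 1) ^ d * B ^ N < r ^ N := by
  have hr : 0 < r := hB.trans_lt hBr
  have hq : |B / r| < 1 := by rwa [abs_of_nonneg (by positivity), div_lt_one hr]
  have tendsto_zero : Tendsto (fun N : ℕ => 2 ^ d * ((N : ℝ) ^ d * (B / r) ^ N)) atTop (𝓝 0) := by
    simpa using (tendsto_pow_const_mul_const_pow_of_abs_lt_one d hq).const_mul (2 ^ d : ℝ)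
  obtain ⟨N, hN, one_le_N⟩ :=
    ((tendsto_zero.eventually_lt_const one_pos).and (eventually_ge_atTop 1)).exists
  rw [div_pow, ← mul_assoc, ← mul_pow, ← mul_div_assoc, div_lt_one (by positivity)] at hN
  have add_one_le : (N : ℝ) + 1 ≤ 2 * N := by
    have : (1 : ℝ) ≤ N := mod_cast one_le_N
    linarith
  exact ⟨N, hN.trans_le' (by gcongr)⟩

section Kronecker

variable {ι : Type*} [Fintype ι] {θ : ι → ℝ} {z : ι → Circle}

-- By `hz`, the terms of equal frequency in the expansion of the `N`-th power have equal phases, so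
-- they cannot cancel.
theorem multinomial_le_pow_of_forall_norm_sum_le [DecidableEq ι]
    (hz : ∀ l : ι → ℤ, ∑ i, l i * θ i = 0 → ∏ i, z i ^ l i = 1)
    {B : ℝ} (hB : ∀ t : ℝ, ‖∑ i, ((Circle.exp (t * θ i) / z i : Circle) : ℂ)‖ ≤ B)
    {N : ℕ} {k : ι → ℕ} (hk : k ∈ Finset.univ.piAntidiag N) :
    (Nat.multinomial Finset.univ k : ℝ) ≤ B ^ N := by
  set μ : (ι → ℕ) → ℝ := fun a => ∑ i, a i * θ i with hμ
  set Z : (ι → ℕ) → Circle := fun a => ∏ i, z i ^ a i with hZ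
  set c : (ι → ℕ) → ℂ := fun a => Nat.multinomial Finset.univ a * ((Z a)⁻¹ : Circle) with hc
  have sum_eq_pow (t : ℝ) : ∑ a ∈ Finset.univ.piAntidiag N, c a * Circle.exp (t * μ a) =
      (∑ i, ((Circle.exp (t * θ i) / z i : Circle) : ℂ)) ^ N := by
    rw [Finset.sum_pow_eq_sum_piAntidiag]
    refine Finset.sum_congr rfl fun a _ => ?_
    have exp_mul_μ : Circle.exp (t * μ a) = ∏ i, Circle.exp (t * θ i) ^ a i := by
      simp only [hμ, Finset.mul_sum, circleExp_sum, ← Circle.exp_natCast_mul, mul_left_comm]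
    have prod_eq : ∏ i, (Circle.exp (t * θ i) / z i) ^ a i = (Z a)⁻¹ * Circle.exp (t * μ a) := by
      simp only [exp_mul_μ, hZ, div_pow, Finset.prod_div_distrib, inv_mul_eq_div]
    simp only [hc, mul_assoc, ← Circle.coe_mul, ← prod_eq, coe_circle_prod, Circle.coe_pow]
  have Z_eq {a : ι → ℕ} (ha : μ a = μ k) : Z a = Z k := by
    have := hz (fun i => a i - k i) (by simpa [sub_mul, sub_eq_zero] using ha)
    simpa [zpow_sub, ← div_eq_mul_inv, Finset.prod_div_distrib, div_eq_one] using this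
  have norm_sum_le := norm_sum_filter_le_of_forall_norm_sum_le (c := c) (μ := μ) (B := B ^ N)
    (fun t => by rw [sum_eq_pow, norm_pow]; exact pow_le_pow_left₀ (norm_nonneg _) (hB t) N) (μ k)
  calc (Nat.multinomial Finset.univ k : ℝ)
      ≤ ∑ a ∈ Finset.univ.piAntidiag N with μ a = μ k, (Nat.multinomial Finset.univ a : ℝ) :=
        Finset.single_le_sum (f := fun a => (Nat.multinomial Finset.univ a : ℝ))
          (fun _ _ => Nat.cast_nonneg _) (Finset.mem_filter.2 ⟨hk, rfl⟩)
    _ = ‖(∑ a ∈ Finset.univ.piAntidiag N with μ a = μ k, (Nat.multinomial Finset.univ a : ℂ)) *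
          ((Z k)⁻¹ : Circle)‖ := by
        rw [norm_mul, Circle.norm_coe, mul_one, ← Nat.cast_sum, ← Nat.cast_sum,
          Complex.norm_natCast]
    _ = ‖∑ a ∈ Finset.univ.piAntidiag N with μ a = μ k, c a‖ := by
        rw [Finset.sum_mul]
        exact congrArg _ (Finset.sum_congr rfl fun a ha => by
          rw [← Z_eq (Finset.mem_filter.1 ha).2])
    _ ≤ B ^ N := norm_sum_le

theorem exists_lt_norm_sum_circleExp_div
    (hz : ∀ l : ι → ℤ, ∑ i, l i * θ i = 0 → ∏ i, z i ^ l i = 1)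
    {B : ℝ} (hB : B < Fintype.card ι) :
    ∃ t : ℝ, B < ‖∑ i, ((Circle.exp (t * θ i) / z i : Circle) : ℂ)‖ := by
  classical
  by_contra! hcon
  obtain ⟨N, hN⟩ := exists_add_one_pow_mul_pow_lt_pow (Fintype.card ι)
    ((norm_nonneg _).trans (hcon 0)) hB
  refine hN.not_ge ?_
  calc (Fintype.card ι : ℝ) ^ N
      = ∑ k ∈ Finset.univ.piAntidiag N, (Nat.multinomial (Finset.univ : Finset ι) k : ℝ) := by
        simpa using Finset.sum_pow_eq_sum_piAntidiag Finset.univ (fun _ : ι => (1 : ℝ)) N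
    _ ≤ ∑ _k ∈ (Finset.univ : Finset ι).piAntidiag N, B ^ N :=
        Finset.sum_le_sum fun _ hk => multinomial_le_pow_of_forall_norm_sum_le hz hcon hk
    _ = ((Finset.univ : Finset ι).piAntidiag N).card * B ^ N := by simp
    _ ≤ (N + 1) ^ Fintype.card ι * B ^ N := by
        have := (norm_nonneg _).trans (hcon 0)
        gcongr
        exact_mod_cast card_univ_piAntidiag_le ι N

end Kronecker

theorem norm_sub_sq_le_of_card_sub_le_norm_sum {ι E : Type*} [Fintype ι] [NormedAddCommGroup E]
    [InnerProductSpace ℝ E] {w : ι → E} (hw : ∀ i, ‖w i‖ ≤ 1) {δ : ℝ}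
    (hδ : Fintype.card ι - δ ≤ ‖∑ i, w i‖) (i j : ι) : ‖w i - w j‖ ^ 2 ≤ 4 * δ := by
  classical
  have norm_sum_le_card (s : Finset ι) : ‖∑ k ∈ s, w k‖ ≤ s.card := by
    simpa using norm_sum_le_of_le s fun k _ => hw k
  obtain rfl | hij := eq_or_ne i j
  · have := norm_sum_le_card Finset.univ
    rw [Finset.card_univ] at this
    simp; linarith
  have norm_add_ge : 2 - δ ≤ ‖w i + w j‖ := by
    have pair_subset : ({i, j} : Finset ι) ⊆ Finset.univ := Finset.subset_univ _
    have card_compl_add_two : ((Finset.univ \ {i, j} : Finset ι).card : ℝ) + 2 =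
        Fintype.card ι := by
      norm_cast
      rw [← Finset.card_pair hij, Finset.card_sdiff_add_card_eq_card pair_subset, Finset.card_univ]
    have norm_add_le := norm_add_le (∑ k ∈ Finset.univ \ {i, j}, w k) (w i + w j)
    rw [← Finset.sum_pair hij, Finset.sum_sdiff pair_subset, Finset.sum_pair hij] at norm_add_le
    have norm_sum_compl_le := norm_sum_le_card (Finset.univ \ {i, j})
    linarith
  have parallelogram := parallelogram_law_with_norm ℝ (w i) (w j)
  have norm_sq_le (k : ι) : ‖w k‖ ^ 2 ≤ 1 := pow_le_one₀ (norm_nonneg _) (hw k)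
  have four_sub_le : 4 - 4 * δ ≤ ‖w i + w j‖ ^ 2 := by
    nlinarith [norm_nonneg (w i + w j), sq_nonneg δ]
  linarith [norm_sq_le i, norm_sq_le j]

theorem mem_closure_range_circleExp_mul {ι : Type*} [Fintype ι] {θ : ι → ℝ} {z : ι → Circle}
    (hz : ∀ l : ι → ℤ, ∑ i, l i * θ i = 0 → ∏ i, z i ^ l i = 1) :
    z ∈ closure (Set.range fun (t : ℝ) i => Circle.exp (t * θ i)) := by
  refine Metric.mem_closure_range_iff.2 fun ε hε => ?_
  -- The additional frequency `0` with phase `1` turns closeness of the phases to each other into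
  -- closeness to `1`.
  have hz_option (l : Option ι → ℤ) (hl : ∑ i, l i * Option.elim i 0 θ = 0) :
      ∏ i, Option.elim i 1 z ^ l i = 1 := by
    simpa using hz (fun i => l (some i)) (by simpa using hl)
  obtain ⟨t, ht⟩ := exists_lt_norm_sum_circleExp_div hz_option
    (B := Fintype.card (Option ι) - ε ^ 2 / 8) (sub_lt_self _ (by positivity))
  refine ⟨t, (dist_pi_lt_iff hε).2 fun i => ?_⟩
  have dist_eq : dist (z i) (Circle.exp (t * θ i)) =
      ‖1 - ((Circle.exp (t * θ i) / z i : Circle) : ℂ)‖ := by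
    change dist (z i : ℂ) (Circle.exp (t * θ i) : ℂ) = _
    rw [Complex.dist_eq, Circle.coe_div, ← div_self (z i).coe_ne_zero, ← sub_div, norm_div,
      Circle.norm_coe, div_one]
  have norm_sub_sq_le := norm_sub_sq_le_of_card_sub_le_norm_sum
    (fun j => (Circle.norm_coe _).le) ht.le none (some i)
  simp only [Option.elim_none, Option.elim_some, mul_zero, Circle.exp_zero, div_one,
    Circle.coe_one, ← dist_eq] at norm_sub_sq_le
  refine lt_of_pow_lt_pow_left₀ 2 hε.le ?_
  linarith [pow_pos hε 2]

theorem isPrimitiveRoot_neg {R : Type*} [CommRing R] [IsDomain R] {ω : R} {q : ℕ}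
    (hω : IsPrimitiveRoot ω (2 * q)) (hq : Odd q) : IsPrimitiveRoot (-ω) q := by
  have two_mul_pos : 0 < 2 * q := by have := hq.pos; positivity
  have pow_eq_neg_one : ω ^ q = -1 :=
    (hω.pow two_mul_pos (mul_comm 2 q)).eq_neg_one_of_two_right
  obtain ⟨r, rfl⟩ := hq
  have neg_eq_sq_pow : -ω = (ω ^ 2) ^ (r + 1) := by
    rw [← pow_mul, show 2 * (r + 1) = 2 * r + 1 + 1 by ring, pow_succ, pow_eq_neg_one, neg_one_mul]
  rw [neg_eq_sq_pow]
  refine (hω.pow two_mul_pos rfl).pow_of_coprime (r + 1) ?_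
  rw [show 2 * r + 1 = r + 1 + r by ring, Nat.coprime_self_add_right]
  simp

section PrimePowerCyclotomic

open Polynomial

variable {K : Type*} [Field K] [CharZero K] {p t : ℕ} {η : K}

theorem dvd_eval_one_of_aeval_eq_zero (hp : p.Prime) (ht : 1 ≤ t)
    (hη : IsPrimitiveRoot η (p ^ t)) {P : ℤ[X]} (hP : aeval η P = 0) : (p : ℤ) ∣ P.eval 1 := by
  have := Fact.mk hp
  have hq : 0 < p ^ t := pow_pos hp.pos t
  have cyclotomic_dvd : cyclotomic (p ^ t) ℤ ∣ P := by
    rw [cyclotomic_eq_minpoly hη hq]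
    exact minpoly.isIntegrallyClosed_dvd (hη.isIntegral hq) hP
  obtain ⟨s, rfl⟩ := Nat.exists_eq_add_of_le' ht
  simpa only [eval_one_cyclotomic_prime_pow] using eval_dvd (x := 1) cyclotomic_dvd

theorem dvd_sum_mul_neg_one_pow_of_sum_eq_zero {ι : Type*} [Fintype ι] (hp : p.Prime)
    (hodd : Odd p) (ht : 1 ≤ t) (hη : IsPrimitiveRoot η (p ^ t)) (e : ι → ℕ) {l c : ι → ℤ}
    (hc : ∀ i, (p : ℤ) ∣ c i) (h : ∑ i, l i * ((-η) ^ e i + ((-η) ^ e i)⁻¹ + c i) = 0) :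
    (p : ℤ) ∣ ∑ i, l i * (-1) ^ e i := by
  have inv_pow_eq (k : ℕ) : (η ^ k)⁻¹ = η ^ ((p ^ t - 1) * k) := by
    refine inv_eq_of_mul_eq_one_right ?_
    rw [← pow_add, add_comm, ← Nat.succ_mul, Nat.succ_eq_add_one,
      Nat.sub_add_cancel (pow_pos hp.pos t), pow_mul, hη.pow_eq_one, one_pow]
  set P : ℤ[X] := ∑ i, (l i : ℤ[X]) *
    ((-1) ^ e i * (X ^ e i + X ^ ((p ^ t - 1) * e i)) + (c i : ℤ[X])) with hP
  have aeval_P : aeval η P = 0 := by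
    rw [← h]
    simp only [hP, map_sum, map_mul, map_add, map_pow, map_neg, map_one, map_intCast, aeval_X,
      neg_pow η, mul_inv, inv_pow_eq, ← inv_pow, inv_neg_one, mul_add]
  have eval_one_P : P.eval 1 = 2 * ∑ i, l i * (-1) ^ e i + ∑ i, l i * c i := by
    simp only [hP, eval_finsetSum, eval_mul, eval_add, eval_pow, eval_neg, eval_one, eval_intCast,
      Int.cast_id, eval_X, one_pow, Finset.mul_sum, ← Finset.sum_add_distrib]
    exact Finset.sum_congr rfl fun i _ => by ring
  have dvd_two_mul : (p : ℤ) ∣ 2 * ∑ i, l i * (-1) ^ e i := by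
    rw [← dvd_add_left (Finset.dvd_sum fun i _ => (hc i).mul_left (l i)), ← eval_one_P]
    exact dvd_eval_one_of_aeval_eq_zero hp ht hη aeval_P
  have isCoprime_two : IsCoprime (p : ℤ) 2 :=
    mod_cast Nat.isCoprime_iff_coprime.2 hodd.coprime_two_right
  exact isCoprime_two.dvd_of_dvd_mul_left dvd_two_mul

end PrimePowerCyclotomic

section Dynamics

open scoped Matrix.Norms.Operator in
theorem exp_mulVec_of_mulVec_eq_smul {𝕜 V : Type*} [RCLike 𝕜] [Fintype V] [DecidableEq V]
    {M : Matrix V V 𝕜} {v : V → 𝕜} {c : 𝕜} (h : M.mulVec v = c • v) :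
    (NormedSpace.exp M).mulVec v = NormedSpace.exp c • v := by
  have pow_mulVec (k : ℕ) : (M ^ k).mulVec v = c ^ k • v := by
    induction k with
    | zero => simp
    | succ k ih =>
      rw [pow_succ, ← Matrix.mulVec_mulVec, h, Matrix.mulVec_smul, ih, smul_smul, pow_succ']
  have hasSum_mulVec := (NormedSpace.exp_series_hasSum_exp' (𝕂 := 𝕜) M).map
    (Matrix.mulVec.addMonoidHomLeft v) (continuous_id.matrix_mulVec continuous_const)
  have hasSum_smul := (NormedSpace.exp_series_hasSum_exp' (𝕂 := 𝕜) c).smul_const v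
  refine hasSum_mulVec.unique (hasSum_smul.congr_fun fun k => ?_)
  change ((k.factorial : 𝕜)⁻¹ • M ^ k).mulVec v = _
  rw [Matrix.smul_mulVec, pow_mulVec, smul_assoc]

variable {V : Type*} [Fintype V] {Γ : SimpleGraph V}

open Classical in
theorem transitionMatrix_mulVec_of_adjMatrix_mulVec_eq_smul {v : V → ℂ} {θ : ℝ}
    (h : (Γ.adjMatrix ℂ).mulVec v = (θ : ℂ) • v) (t : ℝ) :
    (transitionMatrix Γ t).mulVec v = (Circle.exp (t * θ) : ℂ) • v := by
  have smul_mulVec : ((Complex.I * (t : ℂ)) • Γ.adjMatrix ℂ).mulVec v =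
      (((t * θ : ℝ) : ℂ) * Complex.I) • v := by
    rw [Matrix.smul_mulVec, h, smul_smul, Complex.ofReal_mul]
    ring_nf
  rw [transitionMatrix, exp_mulVec_of_mulVec_eq_smul smul_mulVec, Circle.coe_exp,
    Complex.exp_eq_exp_ℂ]

open Classical in
theorem exists_seq_tendsto_transitionMatrix_mulVec {ι : Type*} [Fintype ι] {θ : ι → ℝ}
    {f : ι → V → ℂ} (hf : ∀ i, (Γ.adjMatrix ℂ).mulVec (f i) = (θ i : ℂ) • f i) {z : ι → Circle}
    (hz : z ∈ closure (Set.range fun (t : ℝ) i => Circle.exp (t * θ i))) :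
    ∃ τ : ℕ → ℝ, Tendsto (fun k => (transitionMatrix Γ (τ k)).mulVec (∑ i, f i)) atTop
      (𝓝 (∑ i, (z i : ℂ) • f i)) := by
  obtain ⟨w, hw, tendsto_w⟩ := mem_closure_iff_seq_limit.1 hz
  choose τ hτ using hw
  refine ⟨τ, ?_⟩
  simp only [Matrix.mulVec_sum, transitionMatrix_mulVec_of_adjMatrix_mulVec_eq_smul (hf _)]
  refine tendsto_finsetSum _ fun i _ => Tendsto.smul_const ?_ _
  have tendsto_coe_w : Tendsto (fun k => (w k i : ℂ)) atTop (𝓝 (z i)) :=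
    (continuous_subtype_val.tendsto (z i)).comp (tendsto_pi_nhds.1 tendsto_w i)
  exact tendsto_coe_w.congr fun k => by rw [← hτ]

end Dynamics

open Classical in
theorem adjMatrix_cayleyGraph_mulVec {G R : Type*} [Group G] [Fintype G] [NonAssocSemiring R]
    {S : Set G} (h1 : (1 : G) ∉ S) (hS : ∀ s ∈ S, s⁻¹ ∈ S) (f : G → R) (g : G) :
    ((cayleyGraph S).adjMatrix R).mulVec f g = ∑ s with s ∈ S, f (s * g) := by
  rw [SimpleGraph.adjMatrix_mulVec_apply]
  refine (Finset.sum_nbij (· * g) ?_ (mul_left_injective g).injOn ?_ fun _ _ => rfl).symm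
  · intro s hs
    rw [SimpleGraph.mem_neighborFinset, cayleyGraph_adj h1 hS]
    exact ⟨s, (Finset.mem_filter.1 hs).2, rfl⟩
  · intro h hh
    rw [Finset.mem_coe, SimpleGraph.mem_neighborFinset, cayleyGraph_adj h1 hS] at hh
    obtain ⟨s, hs, rfl⟩ := hh
    exact ⟨s, by simpa using hs, rfl⟩

open QuaternionGroup

variable {n m : ℕ}

theorem genA_zpow (k : ℤ) : genA n ^ k = a (k : ZMod (2 * n)) := by
  obtain ⟨k, rfl | rfl⟩ := k.eq_nat_or_neg
  · simp [genA]
  · simp only [genA, zpow_neg, zpow_natCast, a_one_pow, Int.cast_neg, Int.cast_natCast]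
    rfl

theorem connectionSet_eq :
    connectionSet n m = {a (m : ZMod (2 * n)), a (-(m : ZMod (2 * n)))} ∪ Set.range xa := by
  have genA_pow : genA n ^ m = a (m : ZMod (2 * n)) := a_one_pow m
  have mul_genB : {g | ∃ c ∈ Subgroup.zpowers (genA n), g = c * genB n} = Set.range xa := by
    ext g
    constructor
    · rintro ⟨_, ⟨k, rfl⟩, rfl⟩
      exact ⟨-k, by simp only [genA_zpow, genB, a_mul_xa, zero_sub]⟩
    · rintro ⟨i, rfl⟩
      obtain ⟨k, rfl⟩ := ZMod.intCast_surjective i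
      exact ⟨_, ⟨-k, rfl⟩, by simp only [genA_zpow, genB, a_mul_xa, Int.cast_neg, sub_neg_eq_add,
        zero_add]⟩
  rw [connectionSet, genA_pow, mul_genB]
  rfl

theorem inv_mem_connectionSet {s : QuaternionGroup n} (hs : s ∈ connectionSet n m) :
    s⁻¹ ∈ connectionSet n m := by
  rw [connectionSet_eq] at hs ⊢
  obtain (rfl | rfl) | ⟨i, rfl⟩ := hs
  · exact Or.inl (Or.inr rfl)
  · exact Or.inl (Or.inl (congrArg a (neg_neg _)))
  · exact Or.inr ⟨n + i, rfl⟩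

theorem one_notMem_connectionSet (hm : (m : ZMod (2 * n)) ≠ 0) : 1 ∉ connectionSet n m := by
  rw [connectionSet_eq, one_def]
  rintro ((h | h) | ⟨i, h⟩)
  · exact hm (a.inj h).symm
  · exact hm (neg_eq_zero.1 (a.inj h).symm)
  · exact nomatch h

theorem sum_mem_connectionSet [NeZero n] {M : Type*} [AddCommMonoid M]
    [DecidablePred (· ∈ connectionSet n m)] (hm : (m : ZMod (2 * n)) ≠ -m)
    (F : QuaternionGroup n → M) :
    ∑ s with s ∈ connectionSet n m, F s = F (a m) + F (a (-m)) + ∑ i, F (xa i) := by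
  classical
  have filter_eq : ({s | s ∈ connectionSet n m} : Finset (QuaternionGroup n)) =
      {a (m : ZMod (2 * n)), a (-(m : ZMod (2 * n)))} ∪ Finset.univ.image xa := by
    ext s
    simp [connectionSet_eq, or_assoc]
  have disjoint_image : Disjoint {a (m : ZMod (2 * n)), a (-(m : ZMod (2 * n)))}
      (Finset.univ.image (xa : ZMod (2 * n) → QuaternionGroup n)) := by
    simp [Finset.disjoint_left]
  rw [filter_eq, Finset.sum_union disjoint_image, Finset.sum_pair (by simpa using hm),
    Finset.sum_image fun _ _ _ _ h => xa.inj h]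

open Classical in
theorem adjMatrix_connectionSet_mulVec [NeZero n] {R : Type*} [NonAssocSemiring R]
    (hm : (m : ZMod (2 * n)) ≠ -m) (f : QuaternionGroup n → R) (g : QuaternionGroup n) :
    ((cayleyGraph (connectionSet n m)).adjMatrix R).mulVec f g =
      f (a m * g) + f (a (-m) * g) + ∑ i, f (xa i * g) := by
  have hm0 : (m : ZMod (2 * n)) ≠ 0 := by
    intro h
    simp [h] at hm
  rw [adjMatrix_cayleyGraph_mulVec (one_notMem_connectionSet hm0)
    (fun _ => inv_mem_connectionSet), sum_mem_connectionSet hm fun s => f (s * g)]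

/-- An eigenvector of the adjacency matrix for each frequency `j` and sign `s`: for `j ≠ 0` the
function `a ^ x ↦ exp (π i j x / n)` supported on `⟨a⟩`, for `j = 0` the function equal to `1` on
`⟨a⟩` and to `s` off `⟨a⟩`. Listing the former twice, for `s = ± 1`, gives all vectors the same
weight in the expansion of a basis vector and lets the sums run over a product. -/
noncomputable def eigenvector [NeZero n] (i : ZMod (2 * n) × ℤˣ) : QuaternionGroup n → ℂ
  | a x => ZMod.stdAddChar (x * i.1)
  | xa _ => if i.1 = 0 then (i.2 : ℤ) else 0

/-- The eigenvalue of the adjacency matrix belonging to `eigenvector i`, namely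
`2 cos (π m j / n)` for `i = (j, s)` with `j ≠ 0`, and `2 ± 2 n` for `j = 0`. -/
noncomputable def eigenvalue [NeZero n] (m : ℕ) (i : ZMod (2 * n) × ℤˣ) : ℝ :=
  2 * (ZMod.stdAddChar ((m : ZMod (2 * n)) * i.1)).re +
    ((if i.1 = 0 then 2 * n * (i.2 : ℤ) else 0 : ℤ) : ℝ)

theorem coe_eigenvalue [NeZero n] (m : ℕ) (i : ZMod (2 * n) × ℤˣ) :
    (eigenvalue m i : ℂ) = ZMod.stdAddChar ((m : ZMod (2 * n)) * i.1) +
      (ZMod.stdAddChar ((m : ZMod (2 * n)) * i.1))⁻¹ +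
        (if i.1 = 0 then 2 * n * (i.2 : ℤ) else 0 : ℤ) := by
  rw [ZMod.stdAddChar_apply, ← Circle.coe_inv, Circle.coe_inv_eq_conj, Complex.add_conj,
    eigenvalue, ZMod.stdAddChar_apply]
  simp only [Complex.ofReal_add, Complex.ofReal_mul, Complex.ofReal_ofNat, Complex.ofReal_intCast]

open Classical in
theorem adjMatrix_mulVec_eigenvector [NeZero n] (hm : (m : ZMod (2 * n)) ≠ -m)
    (i : ZMod (2 * n) × ℤˣ) :
    ((cayleyGraph (connectionSet n m)).adjMatrix ℂ).mulVec (eigenvector i) =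
      (eigenvalue m i : ℂ) • eigenvector i := by
  obtain ⟨j, s⟩ := i
  ext (x | x) <;>
    simp only [adjMatrix_connectionSet_mulVec hm, Pi.smul_apply, smul_eq_mul, coe_eigenvalue,
      a_mul_a, a_mul_xa, xa_mul_a, xa_mul_xa, eigenvector]
  · obtain rfl | hj := eq_or_ne j 0
    · simp [ZMod.card]
    · simp [hj, add_mul, AddChar.map_add_eq_mul, AddChar.map_neg_eq_inv]
  · have sum_eq : ∑ y, (ZMod.stdAddChar (((n : ZMod (2 * n)) + x - y) * j) : ℂ) =
        if j = 0 then 2 * n else 0 := by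
      refine (Fintype.sum_equiv (Equiv.subLeft ((n : ZMod (2 * n)) + x)) _
        (fun y => (ZMod.stdAddChar (y * j) : ℂ)) fun _ => rfl).trans ?_
      rw [AddChar.sum_mulShift j (ZMod.isPrimitive_stdAddChar _), ZMod.card]
    rw [sum_eq]
    obtain rfl | hj := eq_or_ne j 0
    · have s_mul_s : ((s : ℤ) : ℂ) * (s : ℤ) = 1 := mod_cast Int.units_coe_mul_self s
      simp only [↓reduceIte, Nat.cast_mul, Nat.cast_ofNat, mul_zero, AddChar.map_zero_eq_one,
        inv_one, Int.cast_mul, Int.cast_ofNat, Int.cast_natCast]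
      linear_combination (-2 * (n : ℂ)) * s_mul_s
    · simp [hj]

theorem sum_stdAddChar_smul_eigenvector [NeZero n]
    (y : ZMod (2 * n)) :
    ∑ i : ZMod (2 * n) × ℤˣ, (ZMod.stdAddChar (-(y * i.1)) : ℂ) • (4 * n : ℂ)⁻¹ • eigenvector i =
      Pi.single (a y) 1 := by
  have hn : (n : ℂ) ≠ 0 := NeZero.ne _
  ext (x | x)
  · have stdAddChar_mul (j : ZMod (2 * n)) : (ZMod.stdAddChar (-(y * j)) : ℂ) *
        ((4 * n : ℂ)⁻¹ * ZMod.stdAddChar (x * j)) =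
        (4 * n : ℂ)⁻¹ * ZMod.stdAddChar (j * (x - y)) := by
      rw [mul_left_comm, ← AddChar.map_add_eq_mul]
      ring_nf
    simp only [Finset.sum_apply, Pi.smul_apply, smul_eq_mul, eigenvector, stdAddChar_mul,
      Fintype.sum_prod_type, Finset.sum_const, Finset.card_univ, ← Finset.smul_sum,
      ← Finset.mul_sum, AddChar.sum_mulShift _ (ZMod.isPrimitive_stdAddChar _), sub_eq_zero,
      ZMod.card, Fintype.card_units_int, Pi.single_apply, a.injEq]
    obtain rfl | hxy := eq_or_ne x y
    · rw [if_pos rfl, if_pos rfl, nsmul_eq_mul, inv_mul_eq_one₀ (by simp [hn])]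
      push_cast
      ring
    · simp [hxy]
  · simp [Fintype.sum_prod_type, eigenvector]

theorem isPrimitiveRoot_stdAddChar_natCast {N k d : ℕ} [NeZero N] (hN : N = k * d) :
    IsPrimitiveRoot (ZMod.stdAddChar (k : ZMod N)) d := by
  have isPrimitiveRoot_one : IsPrimitiveRoot (ZMod.stdAddChar (1 : ZMod N)) N := by
    have := ZMod.stdAddChar_coe (N := N) 1
    rw [Int.cast_one, Int.cast_one, mul_one] at this
    exact this ▸ Complex.isPrimitiveRoot_exp N (NeZero.ne N)
  have := isPrimitiveRoot_one.pow (NeZero.pos N) hN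
  rwa [← AddChar.map_nsmul_eq_pow, nsmul_one] at this

theorem stdAddChar_mul_eq_pow {N : ℕ} [NeZero N] (x j : ZMod N) :
    (ZMod.stdAddChar (x * j) : ℂ) = ZMod.stdAddChar x ^ j.val := by
  rw [← AddChar.map_nsmul_eq_pow, nsmul_eq_mul, ZMod.natCast_zmod_val, mul_comm]

theorem stdAddChar_natCast_mul [NeZero n] (j : ZMod (2 * n)) :
    (ZMod.stdAddChar ((n : ZMod (2 * n)) * j) : ℂ) = (-1) ^ j.val := by
  rw [stdAddChar_mul_eq_pow,
    (isPrimitiveRoot_stdAddChar_natCast (mul_comm 2 n)).eq_neg_one_of_two_right]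

variable {p t : ℕ}

theorem natCast_ne_neg_self (hm : 0 < m) (hmn : m < n) : (m : ZMod (2 * n)) ≠ -m := by
  rw [Ne, ← add_eq_zero_iff_eq_neg, ← Nat.cast_add, ZMod.natCast_eq_zero_iff]
  exact Nat.not_dvd_of_pos_of_lt (by lia) (by lia)

section Phases

variable [NeZero n]

theorem dvd_sum_of_sum_eigenvalue_eq_zero (hp : p.Prime) (hodd : Odd p) (ht : 1 ≤ t)
    (hn : n = p ^ t * m) {l : ZMod (2 * n) × ℤˣ → ℤ} (h : ∑ i, l i * eigenvalue m i = 0) :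
    (p : ℤ) ∣ ∑ i, l i * (-1) ^ i.1.val := by
  have isPrimitiveRoot_stdAddChar :
      IsPrimitiveRoot (ZMod.stdAddChar (m : ZMod (2 * n))) (2 * p ^ t) :=
    isPrimitiveRoot_stdAddChar_natCast (by rw [hn]; ring)
  have p_dvd_n : p ∣ n := hn ▸ (dvd_pow_self p (by lia)).mul_right m
  refine dvd_sum_mul_neg_one_pow_of_sum_eq_zero hp hodd ht
    (isPrimitiveRoot_neg isPrimitiveRoot_stdAddChar hodd.pow)
    (fun i : ZMod (2 * n) × ℤˣ => i.1.val)
    (c := fun i => if i.1 = 0 then 2 * n * (i.2 : ℤ) else 0) (fun i => ?_) ?_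
  · split_ifs
    · exact ((Int.natCast_dvd_natCast.2 p_dvd_n).mul_left 2).mul_right _
    · exact dvd_zero _
  · simp only [neg_neg, ← stdAddChar_mul_eq_pow, ← coe_eigenvalue]
    exact_mod_cast h

/-- The limits of the phases `exp (i τ θ)` at the eigenvalues `θ`: `exp (2 π i / p)` or its inverse,
according to the parity of the frequency of the eigenvector. -/
noncomputable def limitPhase (p : ℕ) (i : ZMod (2 * n) × ℤˣ) : Circle :=
  Circle.exp ((-1) ^ i.1.val * (2 * Real.pi / p))

theorem limitPhase_mem_closure (hp : p.Prime) (hodd : Odd p) (ht : 1 ≤ t) (hn : n = p ^ t * m) :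
    (limitPhase p : ZMod (2 * n) × ℤˣ → Circle) ∈
      closure (Set.range fun (τ : ℝ) i => Circle.exp (τ * eigenvalue m i)) := by
  refine mem_closure_range_circleExp_mul fun l hl => ?_
  obtain ⟨d, hd⟩ := dvd_sum_of_sum_eigenvalue_eq_zero hp hodd ht hn hl
  have hp0 : (p : ℝ) ≠ 0 := mod_cast hp.ne_zero
  calc ∏ i, limitPhase p i ^ l i
      = Circle.exp ((∑ i, l i * (-1) ^ i.1.val : ℤ) * (2 * Real.pi / p)) := by
        simp only [limitPhase, ← Circle.exp_intCast_mul, ← circleExp_sum, Int.cast_sum,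
          Int.cast_mul, Int.cast_pow, Int.cast_neg, Int.cast_one, Finset.sum_mul, mul_assoc]
    _ = Circle.exp (d * (2 * Real.pi)) := by
        rw [hd]
        push_cast
        field_simp
    _ = 1 := Circle.exp_int_mul_two_pi d

theorem coe_limitPhase (p : ℕ) (i : ZMod (2 * n) × ℤˣ) :
    (limitPhase p i : ℂ) = Real.cos (2 * Real.pi / p) +
      Complex.I * Real.sin (2 * Real.pi / p) * ZMod.stdAddChar (-((n : ZMod (2 * n)) * i.1)) := by
  rw [limitPhase, AddChar.map_neg_eq_inv, stdAddChar_natCast_mul, Circle.coe_exp,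
    Complex.exp_mul_I]
  push_cast
  obtain h | h := neg_one_pow_eq_or ℂ i.1.val
  · rw [h, one_mul, inv_one]
    ring
  · rw [h, neg_one_mul, Complex.cos_neg, Complex.sin_neg, inv_neg_one]
    ring

theorem sum_smul_eigenvector :
    ∑ i : ZMod (2 * n) × ℤˣ, (4 * n : ℂ)⁻¹ • eigenvector i = Pi.single (a 0) 1 := by
  simpa using sum_stdAddChar_smul_eigenvector (n := n) 0

theorem sum_limitPhase_smul_eigenvector (p : ℕ) :
    ∑ i : ZMod (2 * n) × ℤˣ, (limitPhase p i : ℂ) • (4 * n : ℂ)⁻¹ • eigenvector i =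
      (Real.cos (2 * Real.pi / p) : ℂ) • Pi.single (a 0) 1 +
        (Complex.I * Real.sin (2 * Real.pi / p)) • Pi.single (a n) 1 := by
  simp only [coe_limitPhase, add_smul, mul_smul (_ * _), Finset.sum_add_distrib]
  rw [← Finset.smul_sum (r := (Real.cos _ : ℂ)), ← Finset.smul_sum (r := Complex.I * _),
    sum_smul_eigenvector, sum_stdAddChar_smul_eigenvector]

theorem exists_seq_tendsto_transitionMatrix_single (hp : p.Prime) (hodd : Odd p) (ht : 1 ≤ t)
    (hn : n = p ^ t * m) :
    ∃ τ : ℕ → ℝ, Tendsto (fun k => (transitionMatrix (cayleyGraph (connectionSet n m))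
      (τ k)).mulVec (Pi.single (a 0) 1)) atTop
        (𝓝 ((Real.cos (2 * Real.pi / p) : ℂ) • Pi.single (a 0) 1 +
          (Complex.I * Real.sin (2 * Real.pi / p)) • Pi.single (a n) 1)) := by
  classical
  have hm : 0 < m := Nat.pos_of_mul_pos_left (hn ▸ NeZero.pos n)
  have hmn : m < n := hn ▸ lt_mul_of_one_lt_left hm (Nat.one_lt_pow (by lia) hp.one_lt)
  have mulVec_eq (i : ZMod (2 * n) × ℤˣ) :
      ((cayleyGraph (connectionSet n m)).adjMatrix ℂ).mulVec ((4 * n : ℂ)⁻¹ • eigenvector i) =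
        (eigenvalue m i : ℂ) • (4 * n : ℂ)⁻¹ • eigenvector i := by
    rw [Matrix.mulVec_smul, adjMatrix_mulVec_eigenvector (natCast_ne_neg_self hm hmn), smul_comm]
  rw [← sum_limitPhase_smul_eigenvector, ← sum_smul_eigenvector]
  exact exists_seq_tendsto_transitionMatrix_mulVec mulVec_eq
    (limitPhase_mem_closure hp hodd ht hn)

end Phases

theorem sin_two_pi_div_pos {p : ℕ} (hp : 3 ≤ p) : 0 < Real.sin (2 * Real.pi / p) := by
  have three_le_cast : (3 : ℝ) ≤ p := mod_cast hp
  refine Real.sin_pos_of_pos_of_lt_pi (by positivity) ?_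
  rw [div_lt_iff₀ (by positivity)]
  nlinarith [Real.pi_pos]

theorem a_zero_ne_a_natCast [NeZero n] : (a 0 : QuaternionGroup n) ≠ a n := by
  rw [Ne, a.injEq, eq_comm, ZMod.natCast_eq_zero_iff]
  exact Nat.not_dvd_of_pos_of_lt (NeZero.pos n) (by have := NeZero.pos n; lia)

end PGFR

theorem mainTheorem6 (p t m n : ℕ) [NeZero n] (hp : p.Prime) (hodd : Odd p) (ht : 1 ≤ t)
    (hm : 1 ≤ m) (hn : n = p ^ t * m) :
    PGFR.AdmitsPGFR (PGFR.cayleyGraph (PGFR.connectionSet n m)) := by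
  have three_le_p : 3 ≤ p := by have := hp.two_le; grind
  obtain ⟨τ, hτ⟩ := PGFR.exists_seq_tendsto_transitionMatrix_single hp hodd ht hn
  refine ⟨.a 0, .a n, PGFR.a_zero_ne_a_natCast, τ, _, _, ?_, ?_, by convert hτ⟩
  · simp only [norm_mul, Complex.norm_I, one_mul, Complex.norm_real, Real.norm_eq_abs, sq_abs,
      Real.cos_sq_add_sin_sq]
  · exact mul_ne_zero Complex.I_ne_zero
      (Complex.ofReal_ne_zero.2 (PGFR.sin_two_pi_div_pos three_le_p).ne')
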